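/- Fix constants $\alpha\in(0,1)$, $\gamma,a,c>0$ and a known $\sigma>0$. For each $n$ let $X=X_n$ be an $n\times p$ matrix, $p=p_n$, of rank $n$, such that $X_S^\top X_S$ is invertible for every $S\subseteq\{1,\dots,p\}$ with $|S|\le n$, where $X_S$ consists of the columns of $X$ with index in $S$. Under $\mathsf E_{\beta^\star}$ the data are $y\sim \mathsf N_n(X\beta^\star,\sigma^2 I)$. Write $S_\beta=\{j:\beta_j\ne 0\}$. With $\hat\beta_S=(X_S^\top X_S)^{-1}X_S^\top y$ and $R=\mathrm{rank}(X)$, the empirical prior on $\mathbb R^p$ is $$\Pi_n(d\beta)=\sum_{|S|\le R}\pi(S)\,\mathsf N_{|S|}\bigl(d\beta_S\mid\hat\beta_S,\sigma^2\gamma^{-1}(X_S^\top X_S)^{-1}\bigr)\otimes\delta_{0}(d\beta_{S^c}),\qquad \pi(S)=\binom{p}{|S|}^{-1}q_n(|S|),$$ where $q_n(s)\propto (cp^a)^{-s}$ on $\{0,1,\dots,R\}$. With the likelihood $L_n(\beta)=\mathsf N_n(y\mid X\beta,\sigma^2I)$, the empirical Bayes posterior is the probability measure $\Pi^n(d\beta)\propto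 L_n(\beta)^\alpha\,\Pi_n(d\beta)$. Let $$h(\beta^\star,\beta)=\Bigl\{\frac1n\sum_{i=1}^n H^2\bigl(\mathsf N(x_i^\top\beta^\star,\sigma^2),\mathsf N(x_i^\top\beta,\sigma^2)\bigr)\Bigr\}^{1/2},$$ where $x_1^\top,\dots,x_n^\top$ are the rows of $X$ and $H^2(f,g)=\int(\sqrt f-\sqrt g)^2$ is the squared Hellinger distance. Theorem. Let $s^\star=s^\star_n\ge1$ be a sequence of integers with $s^\star=o(n)$ and $\log p=O(\log(p/s^\star))$ as $n\to\infty$. Then there exists a constant $M>0$ such that $$\sup_{\beta^\star:\,|S_{\beta^\star}|=s^\star}\mathsf E_{\beta^\star}\,\Pi^n\bigl(\{\beta\in\mathbb R^p: h(\beta^\star,\beta)>M\varepsilon_n\}\bigr)\to0\quad(n\to\infty),\qquad \varepsilon_n^2=n^{-1}s^\star\log(p/s^\star).$$ -/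

import Mathlib

open MeasureTheory ProbabilityTheory Filter Topology Asymptotics
open scoped NNReal ENNReal Matrix

noncomputable section

namespace SparseRegression

/-- The submatrix `X_S` of the design matrix that keeps the columns with index in `S`. -/
def subDesign {n p : ℕ} (X : Matrix (Fin n) (Fin p) ℝ) (S : Finset (Fin p)) :
    Matrix (Fin n) S ℝ :=
  X.submatrix id (fun j : S => (j : Fin p))

/-- The Gram matrix `X_Sᵀ X_S`. -/
def gram {n p : ℕ} (X : Matrix (Fin n) (Fin p) ℝ) (S : Finset (Fin p)) : Matrix S S ℝ :=
  (subDesign X S)ᵀ * subDesign X S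

/-- The least squares estimate `(X_Sᵀ X_S)⁻¹ X_Sᵀ y` in the model with configuration `S`. -/
def leastSquares {n p : ℕ} (X : Matrix (Fin n) (Fin p) ℝ) (S : Finset (Fin p))
    (y : Fin n → ℝ) : S → ℝ :=
  (gram X S)⁻¹ *ᵥ ((subDesign X S)ᵀ *ᵥ y)

/-- The vector in `ℝᵖ` that agrees with `b` on `S` and vanishes off `S`. -/
def zeroExtend {p : ℕ} (S : Finset (Fin p)) (b : S → ℝ) : Fin p → ℝ :=
  fun j => if h : j ∈ S then b ⟨j, h⟩ else 0

/-- The slab `N_{|S|}(β̂_S, σ² γ⁻¹ (X_Sᵀ X_S)⁻¹) ⊗ δ_0` as a measure on `ℝᵖ`: the coordinates in `S`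
are normal, centered at the least squares estimate, the other coordinates are zero. -/
def slab {n p : ℕ} (γ : ℝ) (σ : ℝ≥0) (X : Matrix (Fin n) (Fin p) ℝ) (y : Fin n → ℝ)
    (S : Finset (Fin p)) : Measure (Fin p → ℝ) :=
  (multivariateGaussian (WithLp.toLp 2 (leastSquares X S y))
    (((σ : ℝ) ^ 2 * γ⁻¹) • (gram X S)⁻¹)).map (fun b => zeroExtend S (WithLp.ofLp b))

/-- The truncated geometric mass function `q(s) ∝ (c pᵃ)^{-s}` on `{0, 1, …, R}`. -/
def sizePrior (a c : ℝ) (p R s : ℕ) : ℝ :=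
  ((c * (p : ℝ) ^ a) ^ s)⁻¹ / ∑ k ∈ Finset.range (R + 1), ((c * (p : ℝ) ^ a) ^ k)⁻¹

/-- The prior mass `π(S) = binom(p, |S|)⁻¹ q(|S|)` of a configuration `S` with `|S| ≤ R`. -/
def configPrior {p : ℕ} (a c : ℝ) (R : ℕ) (S : Finset (Fin p)) : ℝ :=
  ((p.choose S.card : ℕ) : ℝ)⁻¹ * sizePrior a c p R S.card

/-- The empirical (data-centered, conjugate, spike-and-slab) prior `Π_n` on `ℝᵖ`, a mixture over
the configurations of size at most `R = rank X`. -/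
def empiricalPrior {n p : ℕ} (γ a c : ℝ) (σ : ℝ≥0) (X : Matrix (Fin n) (Fin p) ℝ)
    (y : Fin n → ℝ) : Measure (Fin p → ℝ) :=
  ∑ S ∈ Finset.univ.filter (fun S : Finset (Fin p) => S.card ≤ X.rank),
    ENNReal.ofReal (configPrior a c X.rank S) • slab γ σ X y S

/-- The likelihood `L_n(β) = N_n(y ∣ Xβ, σ² I)`. -/
def likelihood {n p : ℕ} (σ : ℝ≥0) (X : Matrix (Fin n) (Fin p) ℝ) (y : Fin n → ℝ)
    (β : Fin p → ℝ) : ℝ :=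
  ∏ i, gaussianPDFReal ((X *ᵥ β) i) (σ ^ 2) (y i)

/-- The unnormalized posterior `L_n(β)^α Π_n(dβ)`. -/
def unnormalizedPosterior {n p : ℕ} (α γ a c : ℝ) (σ : ℝ≥0) (X : Matrix (Fin n) (Fin p) ℝ)
    (y : Fin n → ℝ) : Measure (Fin p → ℝ) :=
  (empiricalPrior γ a c σ X y).withDensity
    (fun β => ENNReal.ofReal (likelihood σ X y β ^ α))

/-- The empirical Bayes posterior `Πⁿ(dβ) ∝ L_n(β)^α Π_n(dβ)`. -/
def posterior {n p : ℕ} (α γ a c : ℝ) (σ : ℝ≥0) (X : Matrix (Fin n) (Fin p) ℝ)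
    (y : Fin n → ℝ) : Measure (Fin p → ℝ) :=
  (unnormalizedPosterior α γ a c σ X y Set.univ)⁻¹ • unnormalizedPosterior α γ a c σ X y

/-- The law `N_n(Xβ, σ² I)` of the data `y = Xβ + σz`. -/
def dataLaw {n p : ℕ} (σ : ℝ≥0) (X : Matrix (Fin n) (Fin p) ℝ) (β : Fin p → ℝ) :
    Measure (Fin n → ℝ) :=
  Measure.pi (fun i => gaussianReal ((X *ᵥ β) i) (σ ^ 2))

/-- The Hellinger distance `(∫ (√f - √g)²)^{1/2}` between two densities on the real line. -/
def hellingerDist (f g : ℝ → ℝ) : ℝ :=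
  √(∫ t, (√(f t) - √(g t)) ^ 2)

/-- The conditional Hellinger distance `h_x` between `N(xᵀβ₁, σ²)` and `N(xᵀβ₂, σ²)`. -/
def condHellinger {p : ℕ} (σ : ℝ≥0) (x β₁ β₂ : Fin p → ℝ) : ℝ :=
  hellingerDist (gaussianPDFReal (x ⬝ᵥ β₁) (σ ^ 2)) (gaussianPDFReal (x ⬝ᵥ β₂) (σ ^ 2))

/-- The empirical distribution `Q_n` of the covariate vectors, i.e. of the rows of `X`. -/
def covariateLaw {n p : ℕ} (X : Matrix (Fin n) (Fin p) ℝ) : Measure (Fin p → ℝ) :=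
  (n : ℝ≥0∞)⁻¹ • ∑ i, Measure.dirac (X i)

/-- The unconditional Hellinger distance `h(β₁, β₂) = (∫ h_x²(β₁, β₂) Q_n(dx))^{1/2}`. -/
def avgHellinger {n p : ℕ} (σ : ℝ≥0) (X : Matrix (Fin n) (Fin p) ℝ) (β₁ β₂ : Fin p → ℝ) : ℝ :=
  √(∫ x, condHellinger σ x β₁ β₂ ^ 2 ∂(covariateLaw X))

/-- The configuration `S_β` of `β`: the set of indices of its non-zero coefficients. -/
def config {p : ℕ} (β : Fin p → ℝ) : Finset (Fin p) :=
  Finset.univ.filter (fun j => β j ≠ 0)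

/-- The rate `ε_n = (n⁻¹ s log(p / s))^{1/2}`. -/
def rate (n p s : ℕ) : ℝ :=
  √((n : ℝ)⁻¹ * ((s : ℝ) * Real.log ((p : ℝ) / (s : ℝ))))

end SparseRegression

end

open SparseRegression

namespace SparseRegression

/-! The posterior mass of a bad set is a ratio, and the normalizer can be bounded below for every
`y`, with no exceptional event. The slab on the true configuration is centered at least squares,
which fits at least as well as `β*`, so this slab alone contributes `π(S*) L(β*)^α (1 +
α/γ)^{-s*/2}` (`likelihood_mul_le_lintegral_slab`).

For the numerator, insert the Chernoff weight `exp(t‖Xβ - Xβ*‖²/2σ²)`. On the slab of `S` the noise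
enters through its projection onto the column space of `X_S` and through a linear term along the
bias `m`, the part of `Xβ*` orthogonal to that space. The two are independent; a chi-squared moment
of order `α + 2t < 1` costs a constant `K` per dimension, while `α² ≤ α - t` absorbs the bias term
(`exists_lintegral_slab_le`).

The prior ratio `K/(c p^a)` is eventually at most `1/2`, so the sum over configurations is
geometric. What remains is `(C p^{1+a})^{s*}` against `exp(-tT/2σ²)`, with `T` a multiple of `M² s*
log(p/s*)`; since `log p = O(log(p/s*))`, a large `M` wins. Hellinger distance is dominated by
prediction error. -/

/-! ### Exponential moments of Gaussian vectors. -/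

theorem lintegral_pi_prod {ι : Type*} [Fintype ι] (μ : ι → Measure ℝ)
    [∀ i, IsProbabilityMeasure (μ i)] (f : ι → ℝ → ℝ≥0∞) (hf : ∀ i, Measurable (f i)) :
    ∫⁻ x, ∏ i, f i (x i) ∂(Measure.pi μ) = ∏ i, ∫⁻ t, f i t ∂(μ i) := by
  refine (lintegral_prod_eq_prod_lintegral_of_indepFun Finset.univ
    (fun i (x : ι → ℝ) => f i (x i))
    (iIndepFun_pi fun i => (hf i).aemeasurable)
    fun i => (hf i).comp (measurable_pi_apply i)).trans ?_
  refine Finset.prod_congr rfl fun i _ => ?_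
  exact (measurePreserving_eval μ i).lintegral_comp (hf i)

theorem lintegral_exp_mul_sub_gaussianReal (u m : ℝ) (v : ℝ≥0) :
    ∫⁻ t, ENNReal.ofReal (Real.exp (u * (t - m))) ∂(gaussianReal m v)
      = ENNReal.ofReal (Real.exp (v / 2 * (u * u))) := by
  have h1 : ∀ t, Real.exp (u * (t - m)) = Real.exp (-(u * m)) * Real.exp (u * t) := by
    intro t; rw [← Real.exp_add]; ring_nf
  have h2 := congrFun (mgf_fun_id_gaussianReal (μ := m) (v := v)) u
  simp only [mgf] at h2
  rw [← ofReal_integral_eq_lintegral_ofReal]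
  · simp_rw [h1]
    rw [integral_const_mul, h2, ← Real.exp_add]
    ring_nf
  · simp_rw [h1]
    exact (integrable_exp_mul_gaussianReal u).const_mul _
  · exact ae_of_all _ fun t => (Real.exp_pos _).le

/-- The moment generating function of a centered Gaussian vector with independent coordinates. -/
theorem lintegral_exp_dotProduct_pi_gaussianReal {ι : Type*} [Fintype ι] (u m : ι → ℝ) (v : ℝ≥0) :
    ∫⁻ y, ENNReal.ofReal (Real.exp (u ⬝ᵥ (y - m))) ∂(Measure.pi fun i => gaussianReal (m i) v)
      = ENNReal.ofReal (Real.exp (v / 2 * (u ⬝ᵥ u))) := by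
  have h : ∀ y : ι → ℝ, ENNReal.ofReal (Real.exp (u ⬝ᵥ (y - m)))
      = ∏ i, ENNReal.ofReal (Real.exp (u i * (y i - m i))) := by
    intro y
    rw [← ENNReal.ofReal_prod_of_nonneg fun i _ => (Real.exp_pos _).le, ← Real.exp_sum]
    rfl
  simp_rw [h]
  rw [lintegral_pi_prod _ (fun i t => ENNReal.ofReal (Real.exp (u i * (t - m i))))
    fun i => by fun_prop]
  simp_rw [lintegral_exp_mul_sub_gaussianReal]
  rw [← ENNReal.ofReal_prod_of_nonneg fun i _ => (Real.exp_pos _).le, ← Real.exp_sum,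
    dotProduct, Finset.mul_sum]

/-- Tilting the standard normal density gives a multiple of the centered normal density with
variance `(1 - q)⁻¹`. -/
theorem lintegral_exp_sq_gaussianReal {q : ℝ} (hq : q < 1) :
    ∫⁻ t, ENNReal.ofReal (Real.exp (q / 2 * (t * t))) ∂(gaussianReal 0 1)
      = ENNReal.ofReal (√(1 - q))⁻¹ := by
  have hq' : 0 < 1 - q := by linarith
  obtain ⟨v, hv⟩ : ∃ v : ℝ≥0, (v : ℝ) = (1 - q)⁻¹ := ⟨⟨(1 - q)⁻¹, by positivity⟩, rfl⟩
  have hv0 : v ≠ 0 := by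
    rintro rfl
    simp only [NNReal.coe_zero] at hv
    exact (inv_pos.2 hq').ne hv
  rw [gaussianReal_of_var_ne_zero 0 one_ne_zero, lintegral_withDensity_eq_lintegral_mul _
    (measurable_gaussianPDF 0 1) (by fun_prop)]
  have h : ∀ t, (gaussianPDF 0 1 * fun t => ENNReal.ofReal (Real.exp (q / 2 * (t * t)))) t
      = ENNReal.ofReal (√(1 - q))⁻¹ * gaussianPDF 0 v t := by
    intro t
    simp only [Pi.mul_apply, gaussianPDF, gaussianPDFReal_def]
    rw [← ENNReal.ofReal_mul (by positivity), ← ENNReal.ofReal_mul (by positivity)]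
    congr 1
    rw [mul_assoc, ← Real.exp_add, ← mul_assoc (√(1 - q))⁻¹, ← mul_inv, ← Real.sqrt_mul hq'.le, hv]
    rw [NNReal.coe_one]
    congr 3
    · field_simp
    · field_simp
      ring
  simp_rw [h]
  rw [lintegral_const_mul _ (measurable_gaussianPDF 0 v), lintegral_gaussianPDF_eq_one 0 hv0,
    mul_one]

/-- The moment generating function of a chi-squared variable. -/
theorem lintegral_exp_dotProduct_self_pi_gaussianReal {ι : Type*} [Fintype ι] {q : ℝ}
    (hq : q < 1) :
    ∫⁻ y, ENNReal.ofReal (Real.exp (q / 2 * (y ⬝ᵥ y))) ∂(Measure.pi fun _ : ι => gaussianReal 0 1)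
      = ENNReal.ofReal (√(1 - q))⁻¹ ^ Fintype.card ι := by
  have h : ∀ y : ι → ℝ, ENNReal.ofReal (Real.exp (q / 2 * (y ⬝ᵥ y)))
      = ∏ i, ENNReal.ofReal (Real.exp (q / 2 * (y i * y i))) := by
    intro y
    rw [← ENNReal.ofReal_prod_of_nonneg fun i _ => (Real.exp_pos _).le, ← Real.exp_sum,
      dotProduct, Finset.mul_sum]
  simp_rw [h]
  rw [lintegral_pi_prod _ (fun _ t => ENNReal.ofReal (Real.exp (q / 2 * (t * t))))
    fun i => by fun_prop]
  simp_rw [lintegral_exp_sq_gaussianReal hq]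
  simp

/-! ### Hellinger distance and prediction error. -/

/-- The squared Hellinger distance between two normal densities with common variance is at most
the squared distance of the means over four times the variance. -/
theorem hellingerDist_gaussianPDFReal_sq_le (m₁ m₂ : ℝ) {v : ℝ≥0} (hv : v ≠ 0) :
    hellingerDist (gaussianPDFReal m₁ v) (gaussianPDFReal m₂ v) ^ 2 ≤ (m₁ - m₂) ^ 2 / (4 * v) := by
  have hv' : (0 : ℝ) < v := NNReal.coe_pos.2 (pos_iff_ne_zero.2 hv)
  -- The Hellinger affinity: the geometric mean of the two densities is `e` times the normal density
  -- at the midpoint.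
  set e := Real.exp (-((m₁ - m₂) ^ 2 / (8 * v)))
  have hpt : ∀ t, (√(gaussianPDFReal m₁ v t) - √(gaussianPDFReal m₂ v t)) ^ 2
      = gaussianPDFReal m₁ v t + gaussianPDFReal m₂ v t
        - 2 * e * gaussianPDFReal ((m₁ + m₂) / 2) v t := by
    intro t
    have h1 := gaussianPDFReal_nonneg m₁ v t
    have h2 := gaussianPDFReal_nonneg m₂ v t
    have h3 : √(gaussianPDFReal m₁ v t) * √(gaussianPDFReal m₂ v t)
        = e * gaussianPDFReal ((m₁ + m₂) / 2) v t := by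
      rw [← Real.sqrt_mul h1]
      rw [Real.sqrt_eq_iff_eq_sq (by positivity)
        (mul_nonneg (Real.exp_pos _).le (gaussianPDFReal_nonneg _ _ _))]
      simp only [gaussianPDFReal_def]
      have h4 : Real.exp (-(t - m₁) ^ 2 / (2 * v)) * Real.exp (-(t - m₂) ^ 2 / (2 * v))
          = (Real.exp (-((m₁ - m₂) ^ 2 / (8 * v)))
            * Real.exp (-(t - (m₁ + m₂) / 2) ^ 2 / (2 * v))) ^ 2 := by
        rw [← Real.exp_add, ← Real.exp_add, ← Real.exp_nat_mul]
        congr 1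
        push_cast
        field_simp
        ring
      linear_combination (√(2 * Real.pi * v))⁻¹ ^ 2 * h4
    rw [sub_sq, Real.sq_sqrt h1, Real.sq_sqrt h2, mul_assoc, h3]
    ring
  have hint : ∫ t, (√(gaussianPDFReal m₁ v t) - √(gaussianPDFReal m₂ v t)) ^ 2 = 2 - 2 * e := by
    simp_rw [hpt]
    rw [integral_sub, integral_add, integral_const_mul]
    · simp only [integral_gaussianPDFReal_eq_one _ hv]
      ring
    · exact integrable_gaussianPDFReal _ _
    · exact integrable_gaussianPDFReal _ _
    · exact (integrable_gaussianPDFReal _ _).add (integrable_gaussianPDFReal _ _)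
    · exact (integrable_gaussianPDFReal _ _).const_mul _
  have h1 : 1 - (m₁ - m₂) ^ 2 / (8 * v) ≤ e := by
    have := Real.add_one_le_exp (-((m₁ - m₂) ^ 2 / (8 * v)))
    linarith
  have h2 : (m₁ - m₂) ^ 2 / (4 * v) = 2 * ((m₁ - m₂) ^ 2 / (8 * v)) := by
    field_simp
    ring
  rw [hellingerDist, Real.sq_sqrt (integral_nonneg fun t => sq_nonneg _), hint, h2]
  linarith

theorem avgHellinger_sq_le {n p : ℕ} {σ : ℝ≥0} (hσ : 0 < σ) (X : Matrix (Fin n) (Fin p) ℝ)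
    (β₁ β₂ : Fin p → ℝ) :
    avgHellinger σ X β₁ β₂ ^ 2
      ≤ (n : ℝ)⁻¹ * (((X *ᵥ β₂ - X *ᵥ β₁) ⬝ᵥ (X *ᵥ β₂ - X *ᵥ β₁)) / (4 * (σ : ℝ) ^ 2)) := by
  rw [avgHellinger, Real.sq_sqrt (integral_nonneg fun x => sq_nonneg _), covariateLaw,
    integral_smul_measure,
    integral_finsetSum_measure (μ := fun i => Measure.dirac (X i : Fin p → ℝ))
      fun i _ => integrable_dirac enorm_lt_top]
  simp only [integral_dirac, ENNReal.toReal_inv, ENNReal.toReal_natCast, smul_eq_mul]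
  refine mul_le_mul_of_nonneg_left ?_ (by positivity)
  rw [dotProduct, Finset.sum_div]
  refine Finset.sum_le_sum fun i _ => ?_
  refine (hellingerDist_gaussianPDFReal_sq_le _ _ (pow_pos hσ 2).ne').trans (le_of_eq ?_)
  simp only [Pi.sub_apply, NNReal.coe_pow, Matrix.mulVec]
  ring

/-! ### Sparse vectors and orthogonal projections. -/

theorem measurable_mulVec {m ι : Type*} [Fintype m] [Fintype ι] (A : Matrix m ι ℝ) :
    Measurable fun v : ι → ℝ => A *ᵥ v :=
  (continuous_const.matrix_mulVec continuous_id).measurable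

theorem measurable_zeroExtend {p : ℕ} (S : Finset (Fin p)) : Measurable (zeroExtend S) := by
  refine measurable_pi_iff.2 fun j => ?_
  by_cases h : j ∈ S
  · simpa only [zeroExtend, dif_pos h] using measurable_pi_apply _
  · simp only [zeroExtend, dif_neg h, measurable_const]

theorem mulVec_zeroExtend {n p : ℕ} (X : Matrix (Fin n) (Fin p) ℝ) (S : Finset (Fin p))
    (b : S → ℝ) : X *ᵥ zeroExtend S b = subDesign X S *ᵥ b := by
  ext i
  simp only [Matrix.mulVec, dotProduct, subDesign, Matrix.submatrix_apply, id]
  rw [← Finset.sum_subset (Finset.subset_univ S) fun j _ hj => by simp [zeroExtend, hj],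
    ← Finset.sum_coe_sort S]
  exact Finset.sum_congr rfl fun j _ => by simp [zeroExtend]

theorem zeroExtend_restrict_config {p : ℕ} (β : Fin p → ℝ) :
    zeroExtend (config β) (fun j => β j) = β := by
  ext j
  by_cases h : β j = 0 <;> simp [zeroExtend, config, h]

section Isometry

variable {m ι : Type*} [Fintype m] [Fintype ι]

theorem mulVec_dotProduct_eq (W : Matrix m ι ℝ) (d : ι → ℝ) (y : m → ℝ) :
    W *ᵥ d ⬝ᵥ y = d ⬝ᵥ Wᵀ *ᵥ y := by
  rw [dotProduct_comm, Matrix.dotProduct_mulVec, Matrix.mulVec_transpose, dotProduct_comm]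

variable [DecidableEq ι] {W : Matrix m ι ℝ}

theorem transpose_mulVec_mulVec (hW : Wᵀ * W = 1) (d : ι → ℝ) : Wᵀ *ᵥ W *ᵥ d = d := by
  rw [Matrix.mulVec_mulVec, hW, Matrix.one_mulVec]

theorem mulVec_dotProduct_mulVec (hW : Wᵀ * W = 1) (d e : ι → ℝ) :
    W *ᵥ d ⬝ᵥ W *ᵥ e = d ⬝ᵥ e := by
  rw [mulVec_dotProduct_eq, transpose_mulVec_mulVec hW]

/-- Pythagoras for the orthogonal projection onto the range of an isometry. -/
theorem sub_mulVec_dotProduct_self (hW : Wᵀ * W = 1) (y : m → ℝ) (d : ι → ℝ) :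
    (y - W *ᵥ d) ⬝ᵥ (y - W *ᵥ d)
      = y ⬝ᵥ y - Wᵀ *ᵥ y ⬝ᵥ Wᵀ *ᵥ y + (d - Wᵀ *ᵥ y) ⬝ᵥ (d - Wᵀ *ᵥ y) := by
  simp only [sub_dotProduct, dotProduct_sub, mulVec_dotProduct_mulVec hW]
  rw [dotProduct_comm y (W *ᵥ d), mulVec_dotProduct_eq, dotProduct_comm (Wᵀ *ᵥ y) d]
  ring

end Isometry

/-! ### The slab in orthonormal coordinates. -/

open scoped MatrixOrder in
/-- Under the slab, `Xβ` is distributed as `W (Wᵀ y + σ γ^{-1/2} ζ)`, where `ζ` is standard normal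
and the orthonormal columns of `W` span the column space of `X_S`. -/
theorem exists_isometry_lintegral_slab {n p : ℕ} {γ : ℝ} (hγ : 0 < γ) {σ : ℝ≥0} (hσ : 0 < σ)
    (X : Matrix (Fin n) (Fin p) ℝ) (S : Finset (Fin p)) (hS : IsUnit (gram X S)) :
    ∃ W : Matrix (Fin n) S ℝ, Wᵀ * W = 1 ∧
      (∀ b : S → ℝ, ∃ d, X *ᵥ zeroExtend S b = W *ᵥ d) ∧
      ∀ (y : Fin n → ℝ) (f : (Fin n → ℝ) → ℝ≥0∞), Measurable f →
        ∫⁻ β, f (X *ᵥ β) ∂(slab γ σ X y S)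
          = ∫⁻ ζ, f (W *ᵥ (Wᵀ *ᵥ y + ((σ : ℝ) / √γ) • ζ))
              ∂(Measure.pi fun _ : S => gaussianReal 0 1) := by
  have hσ' : (0 : ℝ) < σ := hσ
  have hdet : IsUnit (gram X S).det := (Matrix.isUnit_iff_isUnit_det _).1 hS
  set κ : ℝ := (σ : ℝ) / √γ with hκ
  have hκ0 : 0 < κ := by positivity
  have hκ2 : (σ : ℝ) ^ 2 * γ⁻¹ = κ ^ 2 := by
    rw [hκ, div_pow, Real.sq_sqrt hγ.le, div_eq_mul_inv]
  set V : Matrix S S ℝ := ((σ : ℝ) ^ 2 * γ⁻¹) • (gram X S)⁻¹ with hV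
  have hpsd : (gram X S).PosSemidef := by
    have := Matrix.posSemidef_conjTranspose_mul_self (subDesign X S)
    rwa [Matrix.conjTranspose_eq_transpose_of_trivial] at this
  have hVpsd : V.PosSemidef := hpsd.inv.smul (by positivity)
  obtain ⟨R, hR, hRR, hRt⟩ : ∃ R : Matrix S S ℝ, R = CFC.sqrt V ∧ R * R = V ∧ Rᵀ = R := by
    refine ⟨CFC.sqrt V, rfl, ?_, ?_⟩
    · exact CFC.sqrt_mul_sqrt_self V (Matrix.nonneg_iff_posSemidef.2 hVpsd)
    · have := (Matrix.nonneg_iff_posSemidef.1 (CFC.sqrt_nonneg V)).isHermitian.eq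
      rwa [Matrix.conjTranspose_eq_transpose_of_trivial] at this
  have hRRG : R * (R * gram X S) = (κ ^ 2) • (1 : Matrix S S ℝ) := by
    rw [← Matrix.mul_assoc, hRR, hV, hκ2, Matrix.smul_mul, Matrix.nonsing_inv_mul _ hdet]
  have hinv : R * ((κ ^ 2)⁻¹ • (R * gram X S)) = 1 := by
    rw [Matrix.mul_smul, hRRG, smul_smul, inv_mul_cancel₀ (by positivity), one_smul]
  -- Using the same root `R` that generates the slab's Gaussian makes `X_S R ζ = W (κ ζ)` hold
  -- exactly, and `W Wᵀ` is the hat matrix.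
  refine ⟨κ⁻¹ • (subDesign X S * R), ?_, ?_, ?_⟩
  · have h : (κ ^ 2)⁻¹ • (R * gram X S) * R = 1 := mul_eq_one_comm.1 hinv
    rw [Matrix.transpose_smul, Matrix.transpose_mul, hRt, Matrix.smul_mul, Matrix.mul_smul,
      smul_smul, Matrix.mul_assoc, ← Matrix.mul_assoc _ _ R, ← gram, ← h, Matrix.smul_mul,
      Matrix.mul_assoc, ← mul_inv, sq]
  · intro b
    refine ⟨κ • (((κ ^ 2)⁻¹ • (R * gram X S)) *ᵥ b), ?_⟩
    rw [mulVec_zeroExtend, Matrix.smul_mulVec, Matrix.mulVec_smul, smul_smul,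
      inv_mul_cancel₀ hκ0.ne', one_smul, Matrix.mulVec_mulVec, Matrix.mul_assoc, hinv,
      Matrix.mul_one]
  · intro y f hf
    have hfX : Measurable fun β => f (X *ᵥ β) := hf.comp (measurable_mulVec X)
    have hz : Measurable fun b : EuclideanSpace ℝ S => zeroExtend S (WithLp.ofLp b) :=
      (measurable_zeroExtend S).comp (by fun_prop)
    have hfz : Measurable fun b : EuclideanSpace ℝ S =>
      f (X *ᵥ zeroExtend S (WithLp.ofLp b)) := hfX.comp hz
    have hg : Measurable fun x : EuclideanSpace ℝ S =>
        f (X *ᵥ zeroExtend S (WithLp.ofLp (WithLp.toLp 2 (leastSquares X S y)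
          + Matrix.toEuclideanCLM (𝕜 := ℝ) (CFC.sqrt V) x))) :=
      hfz.comp (by fun_prop)
    rw [slab, lintegral_map hfX hz, multivariateGaussian, lintegral_map hfz (by fun_prop),
      ← map_pi_eq_stdGaussian, lintegral_map hg (by fun_prop)]
    refine lintegral_congr fun ζ => ?_
    rw [← hR]
    simp only [Matrix.toEuclideanCLM_toLp, WithLp.ofLp_add, mulVec_zeroExtend]
    congr 1
    have h1 : (κ⁻¹ • (subDesign X S * R)) *ᵥ (κ • ζ) = subDesign X S *ᵥ (R *ᵥ ζ) := by
      rw [Matrix.mulVec_smul, Matrix.smul_mulVec, smul_smul, mul_inv_cancel₀ hκ0.ne', one_smul,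
        Matrix.mulVec_mulVec]
    have h2 : κ⁻¹ • (subDesign X S * R) * (κ⁻¹ • (subDesign X S * R))ᵀ
        = subDesign X S * ((gram X S)⁻¹ * (subDesign X S)ᵀ) := by
      rw [Matrix.transpose_smul, Matrix.transpose_mul, hRt, Matrix.smul_mul, Matrix.mul_smul,
        smul_smul, Matrix.mul_assoc, ← Matrix.mul_assoc R R, hRR, hV, hκ2, Matrix.smul_mul,
        Matrix.mul_smul, smul_smul, show κ⁻¹ * κ⁻¹ * κ ^ 2 = 1 by field_simp, one_smul]
    rw [Matrix.mulVec_add, Matrix.mulVec_add, h1, Matrix.mulVec_mulVec y, h2, leastSquares,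
      Matrix.mulVec_mulVec, Matrix.mulVec_mulVec, Matrix.mul_assoc]

/-! ### The tempered likelihood averaged over a slab. -/

theorem likelihood_rpow {n p : ℕ} {σ : ℝ≥0} (hσ : 0 < σ) (X : Matrix (Fin n) (Fin p) ℝ)
    (y : Fin n → ℝ) (β : Fin p → ℝ) (α : ℝ) :
    likelihood σ X y β ^ α = ((√(2 * Real.pi * (σ : ℝ) ^ 2))⁻¹ ^ n) ^ α
      * Real.exp (-(α / (2 * (σ : ℝ) ^ 2)) * ((y - X *ᵥ β) ⬝ᵥ (y - X *ᵥ β))) := by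
  have hσ' : (0 : ℝ) < σ := hσ
  simp only [likelihood, gaussianPDFReal_def]
  rw [Finset.prod_mul_distrib, Finset.prod_const, ← Real.exp_sum, Finset.card_univ,
    Fintype.card_fin, Real.mul_rpow (by positivity) (Real.exp_pos _).le, ← Real.exp_mul,
    NNReal.coe_pow, dotProduct, Finset.mul_sum, Finset.sum_mul]
  congr 2
  refine Finset.sum_congr rfl fun i _ => ?_
  simp only [Pi.sub_apply]
  field_simp

theorem dotProduct_self_nonneg {ι : Type*} [Fintype ι] (v : ι → ℝ) : 0 ≤ v ⬝ᵥ v :=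
  Finset.sum_nonneg fun i _ => mul_self_nonneg (v i)

/-- The mean of the tempered likelihood over a slab, from below. -/
theorem likelihood_mul_le_lintegral_slab {n p : ℕ} {α γ : ℝ} (hα : 0 ≤ α) (hγ : 0 < γ) {σ : ℝ≥0}
    (hσ : 0 < σ) (X : Matrix (Fin n) (Fin p) ℝ) (S : Finset (Fin p)) (hS : IsUnit (gram X S))
    (y : Fin n → ℝ) (b : S → ℝ) :
    ENNReal.ofReal (likelihood σ X y (zeroExtend S b) ^ α)
        * ENNReal.ofReal (√(1 + α / γ))⁻¹ ^ S.card
      ≤ ∫⁻ β, ENNReal.ofReal (likelihood σ X y β ^ α) ∂(slab γ σ X y S) := by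
  have hσ' : (0 : ℝ) < σ := hσ
  obtain ⟨W, hW, hrange, hint⟩ := exists_isometry_lintegral_slab hγ hσ X S hS
  obtain ⟨d, hd⟩ := hrange b
  simp_rw [likelihood_rpow hσ]
  set C := ((√(2 * Real.pi * (σ : ℝ) ^ 2))⁻¹ ^ n) ^ α
  have hC : 0 ≤ C := by positivity
  rw [hint y (fun v => ENNReal.ofReal (C * Real.exp (-(α / (2 * (σ : ℝ) ^ 2))
    * ((y - v) ⬝ᵥ (y - v))))) (by unfold dotProduct; fun_prop), hd]
  have hq : -(α / γ) < 1 := by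
    have : 0 ≤ α / γ := by positivity
    linarith
  have h := lintegral_exp_dotProduct_self_pi_gaussianReal (ι := S) hq
  rw [sub_neg_eq_add, Fintype.card_coe] at h
  rw [← h, ← lintegral_const_mul _ (by unfold dotProduct; fun_prop)]
  refine lintegral_mono fun ζ => ?_
  simp only
  rw [← ENNReal.ofReal_mul (by positivity), mul_assoc, ← Real.exp_add]
  refine ENNReal.ofReal_le_ofReal (mul_le_mul_of_nonneg_left (Real.exp_le_exp.2 ?_) hC)
  rw [sub_mulVec_dotProduct_self hW, sub_mulVec_dotProduct_self hW, add_sub_cancel_left,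
    smul_dotProduct, dotProduct_smul, smul_eq_mul, smul_eq_mul]
  -- The excess residual of `b` over least squares; discarding it makes the bound valid for every
  -- `y`.
  have h1 : 0 ≤ (d - Wᵀ *ᵥ y) ⬝ᵥ (d - Wᵀ *ᵥ y) := dotProduct_self_nonneg _
  have h2 : σ / √γ * (σ / √γ * (ζ ⬝ᵥ ζ)) = (σ : ℝ) ^ 2 / γ * (ζ ⬝ᵥ ζ) := by
    rw [← mul_assoc, div_mul_div_comm, Real.mul_self_sqrt hγ.le, sq]
  have h3 : α / (2 * (σ : ℝ) ^ 2) * (σ ^ 2 / γ * (ζ ⬝ᵥ ζ)) = α / γ / 2 * (ζ ⬝ᵥ ζ) := by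
    field_simp
  have h4 : 0 ≤ α / (2 * (σ : ℝ) ^ 2) * ((d - Wᵀ *ᵥ y) ⬝ᵥ (d - Wᵀ *ᵥ y)) := by positivity
  rw [h2, mul_add _ _ (_ / _ * _)]
  linarith

/-- An exponential moment of the noise: a fraction of the squared length of its projection,
plus a linear term in an orthogonal direction. -/
theorem lintegral_exp_projection_le {n : ℕ} {ι : Type*} [Fintype ι] [DecidableEq ι]
    {σ : ℝ≥0} (hσ : 0 < σ) {q α r : ℝ} (hq0 : 0 ≤ q) (hq : q < 1) (hr : α ^ 2 ≤ r)
    {W : Matrix (Fin n) ι ℝ} (hW : Wᵀ * W = 1) {m : Fin n → ℝ} (hm : Wᵀ *ᵥ m = 0)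
    (μ : Fin n → ℝ) :
    ∫⁻ y, ENNReal.ofReal (Real.exp ((q * (Wᵀ *ᵥ (y - μ) ⬝ᵥ Wᵀ *ᵥ (y - μ))
        - 2 * α * (m ⬝ᵥ (y - μ)) - r * (m ⬝ᵥ m)) / (2 * (σ : ℝ) ^ 2)))
        ∂(Measure.pi fun i => gaussianReal (μ i) (σ ^ 2))
      ≤ ENNReal.ofReal (√(1 - q))⁻¹ ^ Fintype.card ι := by
  have hσ' : (0 : ℝ) < σ := hσ
  -- Linearization: `exp(q‖Wᵀz‖²/2σ²)` is the mean of `exp((√q/σ) η ⬝ᵥ Wᵀz)` over standard normal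
  -- `η`. After Fubini only linear exponents in the noise occur, and no independence argument is
  -- needed.
  set u : (ι → ℝ) → Fin n → ℝ :=
    fun η => (√q / σ) • (W *ᵥ η) - (α / (σ : ℝ) ^ 2) • m with hu
  set k : ℝ := Real.exp (-(r * (m ⬝ᵥ m)) / (2 * (σ : ℝ) ^ 2)) with hk
  have hpt : ∀ y, ENNReal.ofReal (Real.exp ((q * (Wᵀ *ᵥ (y - μ) ⬝ᵥ Wᵀ *ᵥ (y - μ))
        - 2 * α * (m ⬝ᵥ (y - μ)) - r * (m ⬝ᵥ m)) / (2 * (σ : ℝ) ^ 2)))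
      = ∫⁻ η, ENNReal.ofReal k * ENNReal.ofReal (Real.exp (u η ⬝ᵥ (y - μ)))
          ∂(Measure.pi fun _ : ι => gaussianReal 0 1) := by
    intro y
    have h := lintegral_exp_dotProduct_pi_gaussianReal
      ((√q / σ) • (Wᵀ *ᵥ (y - μ))) (0 : ι → ℝ) 1
    simp only [Pi.zero_apply, sub_zero] at h
    have h2 : ∀ η, ENNReal.ofReal (Real.exp (u η ⬝ᵥ (y - μ)))
        = ENNReal.ofReal (Real.exp (-(α / (σ : ℝ) ^ 2) * (m ⬝ᵥ (y - μ))))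
          * ENNReal.ofReal (Real.exp ((√q / σ) • (Wᵀ *ᵥ (y - μ)) ⬝ᵥ η)) := by
      intro η
      rw [← ENNReal.ofReal_mul (Real.exp_pos _).le, ← Real.exp_add, hu]
      simp only [sub_dotProduct, smul_dotProduct, smul_eq_mul, mulVec_dotProduct_eq W]
      rw [dotProduct_comm η]
      congr 2
      ring
    simp_rw [h2]
    rw [lintegral_const_mul _ (by unfold dotProduct; fun_prop),
      lintegral_const_mul _ (by unfold dotProduct; fun_prop), h,
      ← ENNReal.ofReal_mul (Real.exp_pos _).le, ← ENNReal.ofReal_mul (Real.exp_pos _).le,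
      ← Real.exp_add, ← Real.exp_add]
    congr 2
    rw [smul_dotProduct, dotProduct_smul, smul_eq_mul, smul_eq_mul, ← mul_assoc (√q / σ),
      div_mul_div_comm, Real.mul_self_sqrt hq0, NNReal.coe_one]
    field_simp
    ring
  simp_rw [hpt]
  rw [lintegral_lintegral_swap]
  · have hin : ∀ η, ∫⁻ y, ENNReal.ofReal k * ENNReal.ofReal (Real.exp (u η ⬝ᵥ (y - μ)))
          ∂(Measure.pi fun i => gaussianReal (μ i) (σ ^ 2))
        ≤ ENNReal.ofReal (Real.exp (q / 2 * (η ⬝ᵥ η))) := by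
      intro η
      rw [lintegral_const_mul _ (by unfold dotProduct; fun_prop),
        lintegral_exp_dotProduct_pi_gaussianReal,
        ← ENNReal.ofReal_mul (Real.exp_pos _).le, ← Real.exp_add]
      refine ENNReal.ofReal_le_ofReal (Real.exp_le_exp.2 ?_)
      have hWm : W *ᵥ η ⬝ᵥ m = 0 := by rw [mulVec_dotProduct_eq, hm, dotProduct_zero]
      have huu : u η ⬝ᵥ u η = q / (σ : ℝ) ^ 2 * (η ⬝ᵥ η)
          + α ^ 2 / (σ : ℝ) ^ 4 * (m ⬝ᵥ m) := by
        simp only [hu, sub_dotProduct, dotProduct_sub, smul_dotProduct, dotProduct_smul,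
          smul_eq_mul, mulVec_dotProduct_mulVec hW, dotProduct_comm m (W *ᵥ η), hWm]
        have hqq := Real.mul_self_sqrt hq0
        field_simp
        linear_combination (σ : ℝ) ^ 2 * (η ⬝ᵥ η) * hqq
      have hmm : 0 ≤ m ⬝ᵥ m := dotProduct_self_nonneg _
      have hfin : -(r * (m ⬝ᵥ m)) / (2 * (σ : ℝ) ^ 2) + (σ : ℝ) ^ 2 / 2 * (u η ⬝ᵥ u η)
          = q / 2 * (η ⬝ᵥ η) - (r - α ^ 2) * (m ⬝ᵥ m) / (2 * (σ : ℝ) ^ 2) := by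
        rw [huu]
        field_simp
        ring
      rw [NNReal.coe_pow, hfin]
      have : 0 ≤ (r - α ^ 2) * (m ⬝ᵥ m) / (2 * (σ : ℝ) ^ 2) :=
        div_nonneg (mul_nonneg (by linarith) hmm) (by positivity)
      linarith
    exact (lintegral_mono hin).trans (lintegral_exp_dotProduct_self_pi_gaussianReal hq).le
  · refine Measurable.aemeasurable ?_
    refine measurable_const.mul (ENNReal.measurable_ofReal.comp (Real.measurable_exp.comp ?_))
    have h1 : Measurable fun z : (Fin n → ℝ) × (ι → ℝ) => u z.2 :=
      (((measurable_mulVec W).comp measurable_snd).const_smul (√q / (σ : ℝ))).sub_const _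
    simp only [dotProduct]
    refine Finset.measurable_sum _ fun i _ => ?_
    exact ((measurable_pi_apply i).comp h1).mul
      ((measurable_pi_apply i).comp (measurable_fst.sub_const μ))

/-- The mean over a slab of the tempered likelihood ratio, weighted by an exponential of the
prediction error, is bounded by a function of the data of controlled expectation. -/
theorem exists_lintegral_slab_le {n p : ℕ} {α γ t : ℝ} (hα : 0 ≤ α) (ht : 0 ≤ t)
    (ht1 : 2 * t ≤ α) (ht2 : α ^ 2 ≤ α - t) (ht3 : α + 2 * t < 1) (hγ : 0 < γ) {σ : ℝ≥0}
    (hσ : 0 < σ) (X : Matrix (Fin n) (Fin p) ℝ) (S : Finset (Fin p)) (hS : IsUnit (gram X S))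
    (μ : Fin n → ℝ) :
    ∃ g : (Fin n → ℝ) → ℝ≥0∞, Measurable g ∧
      (∀ y, ∫⁻ β, ENNReal.ofReal (Real.exp ((α * ((y - μ) ⬝ᵥ (y - μ)
          - (y - X *ᵥ β) ⬝ᵥ (y - X *ᵥ β)) + t * ((X *ᵥ β - μ) ⬝ᵥ (X *ᵥ β - μ)))
            / (2 * (σ : ℝ) ^ 2))) ∂(slab γ σ X y S) ≤ g y) ∧
      ∫⁻ y, g y ∂(Measure.pi fun i => gaussianReal (μ i) (σ ^ 2))
        ≤ ENNReal.ofReal (√(1 - (α + 2 * t)))⁻¹ ^ S.card := by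
  have hσ' : (0 : ℝ) < σ := hσ
  obtain ⟨W, hW, -, hint⟩ := exists_isometry_lintegral_slab hγ hσ X S hS
  -- The bias of the model `S`: the part of the true mean outside its column space.
  set m := μ - W *ᵥ Wᵀ *ᵥ μ with hm
  have hWm : Wᵀ *ᵥ m = 0 := by
    rw [hm, Matrix.mulVec_sub, transpose_mulVec_mulVec hW, sub_self]
  refine ⟨fun y => ENNReal.ofReal (Real.exp (((α + 2 * t) * (Wᵀ *ᵥ (y - μ) ⬝ᵥ Wᵀ *ᵥ (y - μ))
        - 2 * α * (m ⬝ᵥ (y - μ)) - (α - t) * (m ⬝ᵥ m)) / (2 * (σ : ℝ) ^ 2))), ?_, ?_, ?_⟩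
  · have h1 : Measurable fun y => Wᵀ *ᵥ (y - μ) :=
      (measurable_mulVec Wᵀ).comp (measurable_id.sub_const μ)
    unfold dotProduct
    fun_prop
  · intro y
    rw [hint y (fun v => ENNReal.ofReal (Real.exp ((α * ((y - μ) ⬝ᵥ (y - μ)
      - (y - v) ⬝ᵥ (y - v)) + t * ((v - μ) ⬝ᵥ (v - μ))) / (2 * (σ : ℝ) ^ 2))))
      (by unfold dotProduct; fun_prop)]
    -- The bound on the integrand is uniform in `ζ`, so the slab integral drops out.
    refine (lintegral_mono (g := fun _ => _) fun ζ => ENNReal.ofReal_le_ofReal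
      (Real.exp_le_exp.2 (div_le_div_of_nonneg_right ?_ (by positivity)))).trans
      (by rw [lintegral_const, measure_univ, mul_one])
    set e := ((σ : ℝ) / √γ) • ζ
    have hflip : ∀ v, (v - μ) ⬝ᵥ (v - μ) = (μ - v) ⬝ᵥ (μ - v) := by
      intro v
      rw [← neg_sub μ v, neg_dotProduct_neg]
    have hmm := sub_mulVec_dotProduct_self hW μ (Wᵀ *ᵥ μ)
    rw [sub_self, dotProduct_zero, add_zero, ← hm] at hmm
    have hmz : m ⬝ᵥ (y - μ) = μ ⬝ᵥ (y - μ) - Wᵀ *ᵥ μ ⬝ᵥ Wᵀ *ᵥ (y - μ) := by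
      rw [hm, sub_dotProduct, mulVec_dotProduct_eq]
    obtain ⟨z, rfl⟩ : ∃ z, y = μ + z := ⟨y - μ, by simp⟩
    rw [add_sub_cancel_left] at hmz ⊢
    rw [hflip, sub_mulVec_dotProduct_self hW, sub_mulVec_dotProduct_self hW, add_sub_cancel_left,
      hmm, hmz, Matrix.mulVec_add, add_assoc, add_sub_cancel_left]
    simp only [add_dotProduct, dotProduct_add]
    rw [dotProduct_comm z μ, dotProduct_comm (Wᵀ *ᵥ z) (Wᵀ *ᵥ μ), dotProduct_comm e (Wᵀ *ᵥ z)]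
    -- This gives `‖Wᵀz + e‖² ≤ 2‖Wᵀz‖² + 2‖e‖²`; the resulting `2t‖e‖²` is absorbed by `-α‖e‖²`
    -- because `2t ≤ α`.
    have h1 : 0 ≤ (Wᵀ *ᵥ z - e) ⬝ᵥ (Wᵀ *ᵥ z - e) := dotProduct_self_nonneg _
    have h2 : 0 ≤ e ⬝ᵥ e := dotProduct_self_nonneg _
    simp only [sub_dotProduct, dotProduct_sub] at h1
    rw [dotProduct_comm e (Wᵀ *ᵥ z)] at h1
    nlinarith [mul_nonneg ht h1, mul_nonneg (sub_nonneg.2 ht1) h2]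
  · have h := lintegral_exp_projection_le hσ (by linarith) ht3 ht2 hW hWm μ
    rwa [Fintype.card_coe] at h

/-! ### Prior sums over configurations. -/

/-- The number of configurations of size `k` cancels the binomial factor in `π(S)`. -/
theorem sum_filter_card_le_configPrior_mul {p R : ℕ} (hR : R ≤ p) (a c K : ℝ) :
    ∑ S ∈ Finset.univ.filter (fun S : Finset (Fin p) => S.card ≤ R),
        configPrior a c R S * K ^ S.card
      = ∑ k ∈ Finset.range (R + 1), sizePrior a c p R k * K ^ k := by
  have h := Finset.sum_powerset_apply_card (x := (Finset.univ : Finset (Fin p)))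
    (fun k => if k ≤ R then ((p.choose k : ℕ) : ℝ)⁻¹ * sizePrior a c p R k * K ^ k else 0)
  rw [Finset.powerset_univ, Finset.card_univ, Fintype.card_fin] at h
  rw [Finset.sum_filter]
  simp only [configPrior]
  rw [h, ← Finset.sum_subset (Finset.range_subset_range.2 (Nat.succ_le_succ hR))]
  · refine Finset.sum_congr rfl fun k hk => ?_
    have hk' : k ≤ R := Nat.lt_succ_iff.1 (Finset.mem_range.1 hk)
    have : ((p.choose k : ℕ) : ℝ) ≠ 0 :=
      Nat.cast_ne_zero.2 (Nat.choose_pos (hk'.trans hR)).ne'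
    rw [if_pos hk', nsmul_eq_mul]
    field_simp
  · intro k _ hk
    rw [if_neg fun h => hk (Finset.mem_range.2 (Nat.lt_succ_iff.2 h)), smul_zero]

theorem configPrior_pos {p : ℕ} {a c : ℝ} (hc : 0 < c) (hp : 0 < p) (R : ℕ) (S : Finset (Fin p)) :
    0 < configPrior a c R S := by
  have hp' : (0 : ℝ) < p := Nat.cast_pos.2 hp
  have hS : 0 < p.choose S.card :=
    Nat.choose_pos (by simpa using Finset.card_le_univ S)
  have hu : 0 < c * (p : ℝ) ^ a := by positivity
  have hZ : 0 < ∑ k ∈ Finset.range (R + 1), ((c * (p : ℝ) ^ a) ^ k)⁻¹ :=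
    Finset.sum_pos (fun k _ => by positivity) ⟨0, by simp⟩
  rw [configPrior, sizePrior]
  positivity

/-- The prior moment of `K ^ |S|`, relative to the prior mass of a single configuration. -/
theorem inv_configPrior_mul_sum_le {p R : ℕ} (hR : R ≤ p) {a c K : ℝ} (hc : 0 < c) (hp : 0 < p)
    (hK : 0 ≤ K) (hKu : 2 * K ≤ c * (p : ℝ) ^ a) (S₀ : Finset (Fin p)) :
    (configPrior a c R S₀)⁻¹ * ∑ S ∈ Finset.univ.filter (fun S : Finset (Fin p) => S.card ≤ R),
        configPrior a c R S * K ^ S.card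
      ≤ 2 * (p : ℝ) ^ S₀.card * (c * (p : ℝ) ^ a) ^ S₀.card := by
  have hp' : (0 : ℝ) < p := Nat.cast_pos.2 hp
  have hu : 0 < c * (p : ℝ) ^ a := by positivity
  rw [sum_filter_card_le_configPrior_mul hR]
  set u := c * (p : ℝ) ^ a with hudef
  have hZ : 0 < ∑ k ∈ Finset.range (R + 1), (u ^ k)⁻¹ :=
    Finset.sum_pos (fun k _ => by positivity) ⟨0, by simp⟩
  simp only [configPrior, sizePrior, ← hudef]
  set Z := ∑ k ∈ Finset.range (R + 1), (u ^ k)⁻¹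
  have h1 : ∑ k ∈ Finset.range (R + 1), (u ^ k)⁻¹ / Z * K ^ k
      = (∑ k ∈ Finset.range (R + 1), (K / u) ^ k) / Z := by
    rw [Finset.sum_div]
    refine Finset.sum_congr rfl fun k _ => ?_
    rw [div_pow]
    field_simp
  have h2 : ∑ k ∈ Finset.range (R + 1), (K / u) ^ k ≤ 2 := by
    refine le_trans (Finset.sum_le_sum fun k _ => ?_) (sum_geometric_two_le (R + 1))
    refine pow_le_pow_left₀ (by positivity) ?_ k
    rw [div_le_div_iff₀ hu two_pos]
    linarith
  have h3 : ((p.choose S₀.card : ℕ) : ℝ) ≤ (p : ℝ) ^ S₀.card := by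
    exact_mod_cast Nat.choose_le_pow p S₀.card
  rw [h1, mul_inv, inv_inv, inv_div, div_inv_eq_mul]
  calc ((p.choose S₀.card : ℕ) : ℝ) * (Z * u ^ S₀.card)
        * ((∑ k ∈ Finset.range (R + 1), (K / u) ^ k) / Z)
      = (p.choose S₀.card : ℕ) * u ^ S₀.card * ∑ k ∈ Finset.range (R + 1), (K / u) ^ k := by
        field_simp
    _ ≤ (p : ℝ) ^ S₀.card * u ^ S₀.card * 2 := by gcongr
    _ = 2 * (p : ℝ) ^ S₀.card * u ^ S₀.card := by ring

/-! ### Normalizer, numerator and the nonasymptotic bound. -/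

theorem lintegral_empiricalPrior {n p : ℕ} (γ a c : ℝ) (σ : ℝ≥0) (X : Matrix (Fin n) (Fin p) ℝ)
    (y : Fin n → ℝ) (f : (Fin p → ℝ) → ℝ≥0∞) :
    ∫⁻ β, f β ∂(empiricalPrior γ a c σ X y)
      = ∑ S ∈ Finset.univ.filter (fun S : Finset (Fin p) => S.card ≤ X.rank),
          ENNReal.ofReal (configPrior a c X.rank S) * ∫⁻ β, f β ∂(slab γ σ X y S) := by
  rw [empiricalPrior, lintegral_finsetSum_measure]
  simp only [lintegral_smul_measure, smul_eq_mul]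

/-- The normalizing constant of the posterior is bounded below by the contribution of the true
configuration. -/
theorem le_unnormalizedPosterior_univ {n p : ℕ} {α γ a c : ℝ} (hα : 0 ≤ α) (hγ : 0 < γ)
    (hc : 0 < c) (hp : 0 < p) {σ : ℝ≥0} (hσ : 0 < σ) (X : Matrix (Fin n) (Fin p) ℝ)
    (β₀ : Fin p → ℝ) (hβ₀ : (config β₀).card ≤ X.rank) (hS : IsUnit (gram X (config β₀)))
    (y : Fin n → ℝ) :
    ENNReal.ofReal (configPrior a c X.rank (config β₀)
        * (likelihood σ X y β₀ ^ α * (√(1 + α / γ))⁻¹ ^ (config β₀).card))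
      ≤ unnormalizedPosterior α γ a c σ X y Set.univ := by
  have h := likelihood_mul_le_lintegral_slab hα hγ hσ X _ hS y (fun j => β₀ j)
  rw [zeroExtend_restrict_config] at h
  have hl : 0 ≤ likelihood σ X y β₀ ^ α :=
    Real.rpow_nonneg (Finset.prod_nonneg fun i _ => gaussianPDFReal_nonneg _ _ _) _
  rw [unnormalizedPosterior, withDensity_apply _ MeasurableSet.univ, Measure.restrict_univ,
    lintegral_empiricalPrior, ENNReal.ofReal_mul (configPrior_pos hc hp _ _).le,
    ENNReal.ofReal_mul hl, ENNReal.ofReal_pow (by positivity)]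
  exact (mul_le_mul_right h _).trans (Finset.single_le_sum
    (f := fun S => ENNReal.ofReal (configPrior a c X.rank S)
      * ∫⁻ β, ENNReal.ofReal (likelihood σ X y β ^ α) ∂(slab γ σ X y S))
    (fun _ _ => zero_le) (Finset.mem_filter.2 ⟨Finset.mem_univ _, hβ₀⟩))

theorem likelihood_rpow_pos {n p : ℕ} {σ : ℝ≥0} (hσ : 0 < σ) (X : Matrix (Fin n) (Fin p) ℝ)
    (y : Fin n → ℝ) (β : Fin p → ℝ) (α : ℝ) : 0 < likelihood σ X y β ^ α :=
  Real.rpow_pos_of_pos (Finset.prod_pos fun _ _ => gaussianPDFReal_pos _ _ _ (pow_pos hσ 2).ne') _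

/-- Chernoff's bound for the unnormalized posterior mass of large prediction errors. -/
theorem unnormalizedPosterior_le {n p : ℕ} {α γ a c t T : ℝ} (ht : 0 ≤ t) {σ : ℝ≥0} (hσ : 0 < σ)
    (X : Matrix (Fin n) (Fin p) ℝ) (β₀ : Fin p → ℝ) (y : Fin n → ℝ) :
    unnormalizedPosterior α γ a c σ X y
        {β | T < (X *ᵥ β - X *ᵥ β₀) ⬝ᵥ (X *ᵥ β - X *ᵥ β₀)}
      ≤ ENNReal.ofReal (likelihood σ X y β₀ ^ α * Real.exp (-(t * T) / (2 * (σ : ℝ) ^ 2)))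
        * ∫⁻ β, ENNReal.ofReal (Real.exp ((α * ((y - X *ᵥ β₀) ⬝ᵥ (y - X *ᵥ β₀)
          - (y - X *ᵥ β) ⬝ᵥ (y - X *ᵥ β))
            + t * ((X *ᵥ β - X *ᵥ β₀) ⬝ᵥ (X *ᵥ β - X *ᵥ β₀))) / (2 * (σ : ℝ) ^ 2)))
          ∂(empiricalPrior γ a c σ X y) := by
  have hσ' : (0 : ℝ) < σ := hσ
  have hX := measurable_mulVec X
  have hmeas : MeasurableSet {β | T < (X *ᵥ β - X *ᵥ β₀) ⬝ᵥ (X *ᵥ β - X *ᵥ β₀)} := by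
    refine measurableSet_lt measurable_const ?_
    unfold dotProduct
    fun_prop
  rw [unnormalizedPosterior, withDensity_apply _ hmeas,
    ← lintegral_const_mul _ (by unfold dotProduct; fun_prop)]
  refine (setLIntegral_mono' hmeas fun β hβ => ?_).trans (setLIntegral_le_lintegral _ _)
  have hβ' : T ≤ (X *ᵥ β - X *ᵥ β₀) ⬝ᵥ (X *ᵥ β - X *ᵥ β₀) := le_of_lt hβ
  have hl := likelihood_rpow_pos hσ X y β₀ α
  rw [← ENNReal.ofReal_mul (mul_pos hl (Real.exp_pos _)).le]
  refine ENNReal.ofReal_le_ofReal ?_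
  rw [likelihood_rpow hσ, likelihood_rpow hσ]
  generalize hC : ((√(2 * Real.pi * (σ : ℝ) ^ 2))⁻¹ ^ n) ^ α = C
  have hC0 : 0 ≤ C := hC ▸ by positivity
  rw [mul_assoc, mul_assoc]
  refine mul_le_mul_of_nonneg_left ?_ hC0
  rw [← Real.exp_add, ← Real.exp_add, Real.exp_le_exp]
  have h : 0 ≤ t * ((X *ᵥ β - X *ᵥ β₀) ⬝ᵥ (X *ᵥ β - X *ᵥ β₀) - T) / (2 * (σ : ℝ) ^ 2) :=
    div_nonneg (mul_nonneg ht (sub_nonneg.2 hβ')) (by positivity)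
  refine le_of_sub_nonneg (h.trans (le_of_eq ?_))
  field_simp
  ring

/-- A nonasymptotic bound for the expected posterior mass of large prediction errors. -/
theorem lintegral_posterior_le {n p : ℕ} {α γ a c t : ℝ} (hα : 0 ≤ α) (ht : 0 ≤ t)
    (ht1 : 2 * t ≤ α) (ht2 : α ^ 2 ≤ α - t) (ht3 : α + 2 * t < 1) (hγ : 0 < γ)
    (hc : 0 < c) (hp : 0 < p) {σ : ℝ≥0} (hσ : 0 < σ) (X : Matrix (Fin n) (Fin p) ℝ)
    (hgram : ∀ S : Finset (Fin p), S.card ≤ X.rank → IsUnit (gram X S))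
    (hKu : 2 * (√(1 - (α + 2 * t)))⁻¹ ≤ c * (p : ℝ) ^ a)
    (β₀ : Fin p → ℝ) (hβ₀ : (config β₀).card ≤ X.rank) (T : ℝ) :
    ∫⁻ y, posterior α γ a c σ X y {β | T < (X *ᵥ β - X *ᵥ β₀) ⬝ᵥ (X *ᵥ β - X *ᵥ β₀)}
        ∂(dataLaw σ X β₀)
      ≤ ENNReal.ofReal (2 * (p * (c * (p : ℝ) ^ a) * √(1 + α / γ)) ^ (config β₀).card
          * Real.exp (-(t * T) / (2 * (σ : ℝ) ^ 2))) := by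
  set s := (config β₀).card
  set K := (√(1 - (α + 2 * t)))⁻¹
  set π₀ := configPrior a c X.rank (config β₀)
  set κ := √(1 + α / γ)
  set e := Real.exp (-(t * T) / (2 * (σ : ℝ) ^ 2))
  have hK : 0 ≤ K := by positivity
  have hπ₀ : 0 < π₀ := configPrior_pos hc hp _ _
  have hκ : 0 < κ := by positivity
  have hg := fun (S : Finset (Fin p))
      (hS : S ∈ Finset.univ.filter (fun S : Finset (Fin p) => S.card ≤ X.rank)) =>
    exists_lintegral_slab_le hα ht ht1 ht2 ht3 hγ hσ X S (hgram S (Finset.mem_filter.1 hS).2)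
      (X *ᵥ β₀)
  choose! g hgm hgle hgint using hg
  -- The likelihood at `β₀` cancels between numerator and normalizer. The majorant is measurable in
  -- `y`, so measurability of the posterior mass itself is not needed.
  have hpt : ∀ y, posterior α γ a c σ X y
      {β | T < (X *ᵥ β - X *ᵥ β₀) ⬝ᵥ (X *ᵥ β - X *ᵥ β₀)}
      ≤ ENNReal.ofReal (π₀⁻¹ * κ ^ s * e)
        * ∑ S ∈ Finset.univ.filter (fun S : Finset (Fin p) => S.card ≤ X.rank),
          ENNReal.ofReal (configPrior a c X.rank S) * g S y := by
    intro y
    have hl := likelihood_rpow_pos hσ X y β₀ α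
    set l := likelihood σ X y β₀ ^ α
    have hD := le_unnormalizedPosterior_univ (a := a) hα hγ hc hp hσ X β₀ hβ₀ (hgram _ hβ₀) y
    have hU := unnormalizedPosterior_le (α := α) (γ := γ) (a := a) (c := c) (T := T) ht hσ X β₀ y
    rw [lintegral_empiricalPrior] at hU
    rw [posterior, Measure.smul_apply, smul_eq_mul]
    refine (mul_le_mul' (ENNReal.inv_le_inv.2 hD) hU).trans ?_
    rw [← ENNReal.ofReal_inv_of_pos (by positivity), ← mul_assoc,
      ← ENNReal.ofReal_mul (by positivity)]
    refine mul_le_mul' (ENNReal.ofReal_le_ofReal (le_of_eq ?_))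
      (Finset.sum_le_sum fun S hS => mul_le_mul_right (hgle S hS y) _)
    change (π₀ * (l * κ⁻¹ ^ s))⁻¹ * (l * e) = _
    rw [inv_pow]
    field_simp
  refine (lintegral_mono hpt).trans ?_
  rw [lintegral_const_mul _ (Finset.measurable_sum _ fun S hS => (hgm S hS).const_mul _),
    lintegral_finsetSum _ fun S hS => (hgm S hS).const_mul _]
  have hsum : ∑ S ∈ Finset.univ.filter (fun S : Finset (Fin p) => S.card ≤ X.rank),
        ∫⁻ y, ENNReal.ofReal (configPrior a c X.rank S) * g S y ∂(dataLaw σ X β₀)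
      ≤ ENNReal.ofReal (∑ S ∈ Finset.univ.filter (fun S : Finset (Fin p) => S.card ≤ X.rank),
          configPrior a c X.rank S * K ^ S.card) := by
    rw [ENNReal.ofReal_sum_of_nonneg fun S _ =>
      mul_nonneg (configPrior_pos hc hp _ _).le (by positivity)]
    refine Finset.sum_le_sum fun S hS => ?_
    rw [lintegral_const_mul _ (hgm S hS), ENNReal.ofReal_mul (configPrior_pos hc hp _ _).le,
      ENNReal.ofReal_pow hK]
    exact mul_le_mul_right (hgint S hS) _
  refine (mul_le_mul_right hsum _).trans ?_
  rw [← ENNReal.ofReal_mul (by positivity)]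
  refine ENNReal.ofReal_le_ofReal ?_
  have h := inv_configPrior_mul_sum_le (Matrix.rank_le_width X) hc hp hK hKu (config β₀)
  calc _ = (π₀⁻¹ * ∑ S ∈ Finset.univ.filter (fun S : Finset (Fin p) => S.card ≤ X.rank),
          configPrior a c X.rank S * K ^ S.card) * (κ ^ s * e) := by ring
    _ ≤ (2 * (p : ℝ) ^ s * (c * (p : ℝ) ^ a) ^ s) * (κ ^ s * e) :=
        mul_le_mul_of_nonneg_right h (by positivity)
    _ = _ := by rw [mul_pow, mul_pow]; ring

/-! ### Calibration of the rate and the limit. -/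

theorem setOf_rate_lt_avgHellinger_subset {n p s : ℕ} (hn : 0 < n) {σ : ℝ≥0} (hσ : 0 < σ) {M : ℝ}
    (hM : 0 ≤ M) (hL : 0 ≤ (s : ℝ) * Real.log (p / s)) (X : Matrix (Fin n) (Fin p) ℝ)
    (β₀ : Fin p → ℝ) :
    {β | M * rate n p s < avgHellinger σ X β₀ β}
      ⊆ {β | 4 * (σ : ℝ) ^ 2 * M ^ 2 * (s * Real.log (p / s))
          < (X *ᵥ β - X *ᵥ β₀) ⬝ᵥ (X *ᵥ β - X *ᵥ β₀)} := by
  intro β hβ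
  have hσ' : (0 : ℝ) < σ := hσ
  have hn' : (0 : ℝ) < n := Nat.cast_pos.2 hn
  have h1 : (M * rate n p s) ^ 2 < avgHellinger σ X β₀ β ^ 2 :=
    pow_lt_pow_left₀ hβ (mul_nonneg hM (Real.sqrt_nonneg _)) two_ne_zero
  have h2 := h1.trans_le (avgHellinger_sq_le hσ X β₀ β)
  rw [mul_pow, rate, Real.sq_sqrt (by positivity), mul_left_comm,
    mul_lt_mul_iff_right₀ (by positivity), lt_div_iff₀ (by positivity)] at h2
  rw [Set.mem_ofPred_eq]
  linarith

/-- The comparison of the complexity terms with the Chernoff exponent, for large `p`. -/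
theorem complexity_mul_exp_le {a c κ B E : ℝ} (ha : 0 < a) (hc : 0 < c) (hκ : 0 ≤ κ)
    {p s : ℕ} (hs : 1 ≤ s) (hsp : s ≤ p) (hp : c * κ ≤ p)
    (hlog : Real.log p ≤ B * Real.log (p / s)) (hE : (2 + a) * B + 1 ≤ E) :
    (p * (c * (p : ℝ) ^ a) * κ) ^ s * Real.exp (-(E * (s * Real.log (p / s)))) ≤ s / p := by
  have hs' : (1 : ℝ) ≤ s := Nat.one_le_cast.2 hs
  have hp' : (0 : ℝ) < p := Nat.cast_pos.2 (hs.trans hsp)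
  have hps : 1 ≤ (p : ℝ) / s := by
    rw [one_le_div (by linarith)]
    exact_mod_cast hsp
  set ℓ := Real.log ((p : ℝ) / s) with hℓ
  have hℓ0 : 0 ≤ ℓ := Real.log_nonneg hps
  -- One factor `p` comes from the binomial coefficient; a second one absorbs the constant `c κ`.
  have h1 : p * (c * (p : ℝ) ^ a) * κ ≤ Real.exp ((2 + a) * Real.log p) := by
    calc p * (c * (p : ℝ) ^ a) * κ = p * (p : ℝ) ^ a * (c * κ) := by ring
      _ ≤ p * (p : ℝ) ^ a * p := by gcongr
      _ = (p : ℝ) ^ (2 + a) := by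
        rw [Real.rpow_add hp', Real.rpow_two]
        ring
      _ = Real.exp ((2 + a) * Real.log p) := by rw [Real.rpow_def_of_pos hp', mul_comm]
  calc (p * (c * (p : ℝ) ^ a) * κ) ^ s * Real.exp (-(E * (s * ℓ)))
      ≤ Real.exp ((2 + a) * Real.log p) ^ s * Real.exp (-(E * (s * ℓ))) := by gcongr
    _ = Real.exp (s * ((2 + a) * Real.log p) - E * (s * ℓ)) := by
      rw [← Real.exp_nat_mul, ← Real.exp_add, sub_eq_add_neg]
    _ ≤ Real.exp (-ℓ) := by
      refine Real.exp_le_exp.2 ?_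
      have h2 : (s : ℝ) * ((2 + a) * Real.log p) ≤ s * ((2 + a) * (B * ℓ)) := by gcongr
      have h3 : ((2 + a) * B + 1) * (s * ℓ) ≤ E * (s * ℓ) := by gcongr
      -- The `+ 1` in the lower bound on `E` leaves `exp(-sℓ) ≤ exp(-ℓ) = s/p`.
      have h4 : 1 * ℓ ≤ s * ℓ := by gcongr
      linarith
    _ = s / p := by rw [Real.exp_neg, hℓ, Real.exp_log (by linarith), inv_div]

end SparseRegression

theorem theorem1
    -- fixed hyperparameters and the known error standard deviation
    (α γ a c : ℝ) (hα : α ∈ Set.Ioo (0 : ℝ) 1) (hγ : 0 < γ) (ha : 0 < a) (hc : 0 < c)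
    (σ : ℝ≥0) (hσ : 0 < σ)
    -- dimension, design matrix, sparsity level as functions of the sample size
    (p : ℕ → ℕ) (X : (n : ℕ) → Matrix (Fin n) (Fin (p n)) ℝ) (s : ℕ → ℕ)
    (hrank : ∀ n, (X n).rank = n)
    -- the inverses in the definition of the prior exist
    (hgram : ∀ (n : ℕ) (S : Finset (Fin (p n))), S.card ≤ (X n).rank → IsUnit (gram (X n) S))
    (hs_pos : ∀ n, 1 ≤ s n)
    (hs : (fun n => (s n : ℝ)) =o[atTop] (fun n => (n : ℝ)))
    (hp : (fun n => Real.log (p n : ℝ)) =O[atTop]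
      (fun n => Real.log ((p n : ℝ) / (s n : ℝ)))) :
    ∃ M : ℝ, 0 < M ∧
      Tendsto (fun n : ℕ =>
        ⨆ βstar ∈ {β : Fin (p n) → ℝ | (config β).card = s n},
          ∫⁻ y, posterior α γ a c σ (X n) y
              {β : Fin (p n) → ℝ | M * rate n (p n) (s n) < avgHellinger σ (X n) βstar β}
            ∂(dataLaw σ (X n) βstar))
        atTop (𝓝 (0 : ℝ≥0∞)) := by
  obtain ⟨hα0, hα1⟩ := hα
  have hσ' : (0 : ℝ) < σ := hσ
  have hα' : 0 < α * (1 - α) := mul_pos hα0 (sub_pos.2 hα1)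
  -- Small enough for all three constraints: `α - α² = 4t`, and `1 - α - 2t = (1 - α)(1 - α/2) > 0`.
  set t : ℝ := α * (1 - α) / 4 with ht
  have ht0 : 0 < t := by positivity
  have ht1 : 2 * t ≤ α := by nlinarith
  have ht2 : α ^ 2 ≤ α - t := by nlinarith
  have ht3 : α + 2 * t < 1 := by nlinarith
  obtain ⟨B, hB, hpB⟩ := hp.exists_pos
  have hpn : ∀ n, n ≤ p n := fun n => (hrank n).symm.le.trans (Matrix.rank_le_width (X n))
  have hptop : Tendsto (fun n => (p n : ℝ)) atTop atTop :=
    tendsto_natCast_atTop_atTop.comp (tendsto_atTop_mono hpn tendsto_id)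
  have hutop : Tendsto (fun n => c * (p n : ℝ) ^ a) atTop atTop :=
    ((tendsto_rpow_atTop ha).comp hptop).const_mul_atTop hc
  -- With `T = 4σ²M² s log(p/s)` the Chernoff exponent is `2tM² s log(p/s)`; this `M` makes its
  -- coefficient exactly `(2 + a)B + 1`.
  set M : ℝ := √(((2 + a) * B + 1) / (2 * t)) with hM
  have hM0 : 0 < M := by positivity
  have hM2 : 2 * t * M ^ 2 = (2 + a) * B + 1 := by
    rw [hM, Real.sq_sqrt (by positivity)]
    field_simp
  -- The final bound `2s/p` is at most `2s/n`, since rank `n` forces `p ≥ n`.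
  have hlim : Tendsto (fun n => ENNReal.ofReal (2 * ((s n : ℝ) / n))) atTop (𝓝 0) := by
    have h := ENNReal.tendsto_ofReal (hs.tendsto_div_nhds_zero.const_mul 2)
    rwa [mul_zero, ENNReal.ofReal_zero] at h
  refine ⟨M, hM0, tendsto_of_tendsto_of_tendsto_of_le_of_le' tendsto_const_nhds hlim
    (Eventually.of_forall fun n => zero_le) ?_⟩
  filter_upwards [hs.bound one_pos, hpB.bound, eventually_gt_atTop 0,
    hptop.eventually_ge_atTop (c * √(1 + α / γ)),
    hutop.eventually_ge_atTop (2 * (√(1 - (α + 2 * t)))⁻¹)] with n hsn hlogn hn hpc hKu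
  have hsn' : s n ≤ n := by
    rw [one_mul, Real.norm_natCast, Real.norm_natCast] at hsn
    exact_mod_cast hsn
  have hn' : (0 : ℝ) < n := Nat.cast_pos.2 hn
  have hs' : (0 : ℝ) < s n := Nat.cast_pos.2 (hs_pos n)
  have hp0 : 0 < p n := hn.trans_le (hpn n)
  have hnp : (n : ℝ) ≤ p n := Nat.cast_le.2 (hpn n)
  have hℓ : 0 ≤ Real.log ((p n : ℝ) / s n) := by
    refine Real.log_nonneg ((one_le_div hs').2 ?_)
    exact_mod_cast hsn'.trans (hpn n)
  have hlog : Real.log (p n) ≤ B * Real.log ((p n : ℝ) / s n) := by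
    rw [Real.norm_of_nonneg hℓ] at hlogn
    exact (le_abs_self _).trans hlogn
  refine iSup₂_le fun β hβ => ?_
  have hβ' : (config β).card = s n := hβ
  refine (lintegral_mono fun y => measure_mono (setOf_rate_lt_avgHellinger_subset hn hσ hM0.le
    (mul_nonneg hs'.le hℓ) (X n) β)).trans ?_
  refine (lintegral_posterior_le hα0.le ht0.le ht1 ht2 ht3 hγ hc hp0 hσ (X n) (hgram n) hKu β
    (by rw [hβ', hrank]; exact hsn') _).trans (ENNReal.ofReal_le_ofReal ?_)
  rw [hβ', mul_assoc]
  have h := complexity_mul_exp_le ha hc (Real.sqrt_nonneg (1 + α / γ)) (hs_pos n)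
    (hsn'.trans (hpn n)) hpc hlog hM2.ge
  have hexp : -(t * (4 * (σ : ℝ) ^ 2 * M ^ 2 * (s n * Real.log ((p n : ℝ) / s n))))
        / (2 * (σ : ℝ) ^ 2)
      = -(2 * t * M ^ 2 * (s n * Real.log ((p n : ℝ) / s n))) := by
    field_simp
    ring
  rw [hexp]
  refine mul_le_mul_of_nonneg_left (h.trans ?_) two_pos.le
  gcongr
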